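/- Let $\Sigma$ be a finite set of letters that is partitioned into calls $\Sigma_c$, returns $\Sigma_r$ and local actions $\Sigma_l$, and let $\bot$ be a fresh symbol, $\Sigma_\bot = \Sigma\cup\{\bot\}$. The stack height of a finite word is defined by $\mathit{sh}(\varepsilon)=0$, $\mathit{sh}(wc)=\mathit{sh}(w)+1$ for $c\in\Sigma_c$, $\mathit{sh}(wr)=\max\{0,\mathit{sh}(w)-1\}$ for $r\in\Sigma_r$, and $\mathit{sh}(wl)=\mathit{sh}(w)$ for $l\in\Sigma_l$. In a finite or infinite word $\alpha=\alpha_0\alpha_1\cdots$, a call $\alpha_k\in\Sigma_c$ is matched if there is a $k'>k$ with $\alpha_{k'}\in\Sigma_r$ and $\mathit{sh}(\alpha_0\cdots\alpha_{k-1})=\mathit{sh}(\alpha_0\cdots\alpha_{k'})$; the return at the smallest such $k'$ is its matching return. A call that is not matched is unmatched. For a set $X$, an $X$-tree is a map $t\colon\{0,1\}^*\to X$; write $x\langle t_0,t_1\rangle$ for the $X$-tree with root label $x$, left-hand subtree $t_0$ (at node $0$) and right-hand subtree $t_1$ (at node $1$). The function $\mathrm{st}$ assigns a $\Sigma_\bot$-tree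 to each finite or infinite word over $\Sigma$ as follows: * $\mathrm{st}(\varepsilon)=\bot\langle\mathrm{st}(\varepsilon),\mathrm{st}(\varepsilon)\rangle$, so all nodes are labeled with $\bot$; * $\mathrm{st}(c\,w\,r\,\alpha)=c\langle\mathrm{st}(r\alpha),\mathrm{st}(w)\rangle$ if $c\in\Sigma_c$ and the displayed $r$ is the matching return of $c$; * $\mathrm{st}(c\,\alpha)=c\langle\mathrm{st}(\varepsilon),\mathrm{st}(\alpha)\rangle$ if $c\in\Sigma_c$ is unmatched; * $\mathrm{st}(x\,\alpha)=x\langle\mathrm{st}(\alpha),\mathrm{st}(\varepsilon)\rangle$ if $x\in\Sigma_l\cup\Sigma_r$. A (nondeterministic) Büchi tree automaton over an alphabet $X$ consists of a finite set $Q$ of states, a transition relation $\Delta\subseteq Q\times X\times Q\times Q$, an initial state $q_I\in Q$ and a set $Q_F\subseteq Q$ of accepting states. It accepts an $X$-tree $t$ if there is a $Q$-tree $r$ with $r(\varepsilon)=q_I$ and $(r(b),t(b),r(b0),r(b1))\in\Delta$ for all $b\in\{0,1\}^*$ such that every infinite branch of $\{0,1\}^*$ contains infinitely many nodes $b$ with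 $r(b)\in Q_F$. **Theorem.** The set $\mathrm{st}(\Sigma^\omega)=\{\mathrm{st}(\alpha)\mid\alpha\in\Sigma^\omega\}$ of the stack trees of all infinite words is regular: there is a Büchi tree automaton over $\Sigma_\bot$ that accepts exactly the trees in $\mathrm{st}(\Sigma^\omega)$. -/

import Mathlib

/-- The three sorts of letters of a pushdown alphabet. -/
inductive LetterKind where
  | call
  | ret
  | loc

/-- A pushdown alphabet on the set `A` of letters: a partition of `A` into calls, returns and
local actions, given by the function that maps each letter to its part. -/
structure PushdownAlphabet (A : Type*) where
  kind : A → LetterKind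

namespace PushdownAlphabet

variable {A : Type*} (S : PushdownAlphabet A)

/-- The set of calls. -/
def calls : Set A := {a | S.kind a = LetterKind.call}

/-- The set of returns. -/
def returns : Set A := {a | S.kind a = LetterKind.ret}

/-- The set of local actions. -/
def locals : Set A := {a | S.kind a = LetterKind.loc}

/-- The effect of one letter on the stack height. A return on the empty stack leaves it empty:
the subtraction of natural numbers is `max 0 (h - 1)`. -/
def heightStep (h : ℕ) (a : A) : ℕ :=
  match S.kind a with
  | LetterKind.call => h + 1
  | LetterKind.ret => h - 1
  | LetterKind.loc => h

/-- The stack height reached after reading a finite word from left to right. -/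
def stackHeight (w : List A) : ℕ := w.foldl S.heightStep 0

/-- Finite and infinite words are both elements of `Stream'.Seq A`. In the word `u` there is a call at
position `k`, and `k'` is the position of its matching return: the smallest position after `k` that
carries a return and after which the stack height is again the one before the call. -/
def IsMatchingReturn (u : Stream'.Seq A) (k k' : ℕ) : Prop :=
  (∃ c ∈ u.get? k, c ∈ S.calls) ∧
    IsLeast {j | k < j ∧ (∃ r ∈ u.get? j, r ∈ S.returns) ∧
      S.stackHeight (u.take k) = S.stackHeight (u.take (j + 1))} k'

open Classical in
/-- The word that is encoded in the left-hand subtree of the stack tree of a word: if the word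
starts with a matched call, the suffix that starts with the matching return; if it starts with an
unmatched call, the empty word; if it starts with a return or a local action, the remaining word. -/
noncomputable def leftWord (u : Stream'.Seq A) : Stream'.Seq A :=
  match u.head with
  | none => Stream'.Seq.nil
  | some a =>
    if a ∈ S.calls then
      if h : ∃ k', S.IsMatchingReturn u 0 k' then u.drop h.choose else Stream'.Seq.nil
    else u.tail

open Classical in
/-- The word that is encoded in the right-hand subtree of the stack tree of a word: if the word
starts with a matched call, the nested infix, which lies strictly between the call and its matching
return; if it starts with an unmatched call, the remaining word; if it starts with a return or a
local action, the empty word. -/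
noncomputable def rightWord (u : Stream'.Seq A) : Stream'.Seq A :=
  match u.head with
  | none => Stream'.Seq.nil
  | some a =>
    if a ∈ S.calls then
      if h : ∃ k', S.IsMatchingReturn u 0 k' then Stream'.Seq.ofList (u.tail.take (h.choose - 1))
      else u.tail
    else Stream'.Seq.nil

end PushdownAlphabet

/-- Nodes of the infinite binary tree: finite words over the Booleans, where `false` is the
direction to the left and `true` the direction to the right. The children of `b` are
`b ++ [false]` and `b ++ [true]`. -/
abbrev TreeNode := List Bool

/-- Infinite binary trees with labels in `B`. -/
abbrev LabeledTree (B : Type*) := TreeNode → B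

/-- The stack tree of a finite or infinite word. `none : Option A` is the fresh symbol `⊥`. -/
noncomputable def stackTree {A : Type*} (S : PushdownAlphabet A) :
    Stream'.Seq A → LabeledTree (Option A)
  | u, [] => u.head
  | u, false :: b => stackTree S (S.leftWord u) b
  | u, true :: b => stackTree S (S.rightWord u) b


/-- The set of the stack trees of all infinite words. -/
def stackTrees {A : Type*} (S : PushdownAlphabet A) : Set (LabeledTree (Option A)) :=
  {t | ∃ α : Stream' A, t = stackTree S (Stream'.Seq.ofStream α)}

/-- The prefix of length `n` of a branch. -/
def branchPrefix (β : ℕ → Bool) (n : ℕ) : TreeNode := (List.range n).map β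

/-- A nondeterministic tree automaton with Büchi acceptance, with alphabet `B` and set `Q` of
states (finiteness of `Q` is required where the automata are quantified over). -/
structure BuchiTreeAutomaton (B Q : Type*) where
  trans : Set (Q × B × Q × Q)
  init : Q
  accept : Set Q

namespace BuchiTreeAutomaton

variable {B Q : Type*} (T : BuchiTreeAutomaton B Q)

/-- `r` is a run on the tree `t`. -/
def IsRun (t : LabeledTree B) (r : LabeledTree Q) : Prop :=
  r [] = T.init ∧ ∀ b : TreeNode, (r b, t b, r (b ++ [false]), r (b ++ [true])) ∈ T.trans

/-- Every branch of `r` contains infinitely many nodes labeled with accepting states. -/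
def IsAccepting (r : LabeledTree Q) : Prop :=
  ∀ β : ℕ → Bool, {n : ℕ | r (branchPrefix β n) ∈ T.accept}.Infinite

/-- The set of the trees that have an accepting run. -/
def language : Set (LabeledTree B) :=
  {t | ∃ r, T.IsRun t r ∧ T.IsAccepting r}

end BuchiTreeAutomaton

/-- A set of trees is regular if some Büchi tree automaton with finitely many states
recognizes it. -/
def IsRegularTreeSet {B : Type*} (L : Set (LabeledTree B)) : Prop :=
  ∃ (Q : Type) (_ : Finite Q) (T : BuchiTreeAutomaton B Q), T.language = L

/-!
The automaton descends through the equations that define `stackTree` and keeps in its state what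
is known about the encoded word: it is empty, a balanced finite word, an infinite word without
unmatched returns, or an arbitrary infinite word. For every call it guesses whether the call is
matched. The guess can be checked since the word after an unmatched call has no unmatched return,
and a word has an unmatched return exactly if it starts with a balanced word followed by a return.

The states that expect balanced words are the only nonaccepting ones, so these words are finite in
every tree that is accepted. Conversely, an accepted tree is decoded from the top: a letter that is
not a matched call is read off directly, and a matched call together with its decoded right-hand
subtree and its return, which is the left-hand child, forms one block. The concatenation of the
blocks is an infinite word whose stack tree agrees with the given tree up to every depth.
-/

open Filter
open Stream' (Seq)
open Stream'.Seq (cons nil append ofList ofStream)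

section Words

variable {A X : Type*}

theorem take_append (w : List A) (u : Seq A) (n : ℕ) :
    (append (ofList w) u).take n = w.take n ++ u.take (n - w.length) := by
  induction w generalizing n with
  | nil => simp
  | cons a w ih => cases n <;> simp [Seq.cons_append, ih]

theorem drop_length_append (w : List A) (u : Seq A) :
    (append (ofList w) u).drop w.length = u := by
  induction w with
  | nil => simp
  | cons a w ih => simp [Seq.cons_append, ih]

theorem terminates_append_iff {w : List A} {u : Seq A} :
    (append (ofList w) u).Terminates ↔ u.Terminates := by
  induction w with
  | nil => simp
  | cons a w ih => simp [Seq.cons_append, ih]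

theorem range_ofStream : Set.range (ofStream : Stream' A → Seq A) = {u | ¬ u.Terminates} := by
  ext u
  refine ⟨?_, fun hu => ⟨u.toStream hu, Stream'.Seq.ext fun n => Option.some_get _⟩⟩
  rintro ⟨α, rfl⟩
  exact Seq.not_terminates_iff.2 fun n => rfl

theorem exists_forall_eq_append {x : X → List A} (hx : ∀ s, x s ≠ []) (f : X → X) :
    ∃ v : X → Seq A, ∀ s, v s = append (ofList (x s)) (v (f s)) := by
  let block (s : X) : Option (Stream'.Seq1 A × X) :=
    some (((x s).head (hx s), ofList (x s).tail), f s)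
  refine ⟨fun s => Seq.join (Seq.corec block s), fun s => ?_⟩
  calc Seq.join (Seq.corec block s)
    _ = Seq.join (cons ((x s).head (hx s), ofList (x s).tail) (Seq.corec block (f s))) := by
      rw [Seq.corec_cons rfl]
    _ = append (ofList (x s)) (Seq.join (Seq.corec block (f s))) := by
      rw [Seq.join_cons, ← Seq.cons_append, ← Seq.ofList_cons, List.cons_head_tail]

theorem not_terminates_of_forall_eq_append {x : X → List A} (hx : ∀ s, x s ≠ []) {f : X → X}
    {v : X → Seq A} (hv : ∀ s, v s = append (ofList (x s)) (v (f s))) (s : X) :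
    ¬ (v s).Terminates := by
  suffices ∀ w s, v s ≠ ofList w from fun h => this _ s (Seq.ofList_toList _ h).symm
  intro w
  induction hn : w.length using Nat.strong_induction_on generalizing w with
  | _ n ih =>
  intro s hw
  have hf : (v (f s)).Terminates := by
    rw [← terminates_append_iff (w := x s), ← hv, hw]
    exact Seq.terminates_ofList w
  obtain ⟨w', hw'⟩ : ∃ w', v (f s) = ofList w' := ⟨_, (Seq.ofList_toList _ hf).symm⟩
  have hlen : w = x s ++ w' :=
    Seq.ofList_injective (by rw [← hw, hv, hw', Seq.ofList_append])
  have := List.length_pos_iff.2 (hx s)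
  exact ih w'.length (by simp only [← hn, hlen, List.length_append]; omega) w' rfl (f s) hw'

end Words

namespace PushdownAlphabet

variable {A X : Type*} {S : PushdownAlphabet A}

theorem heightStep_call {c : A} (hc : c ∈ S.calls) (h : ℕ) : S.heightStep h c = h + 1 := by
  rw [heightStep, show S.kind c = _ from hc]

theorem heightStep_return {r : A} (hr : r ∈ S.returns) (h : ℕ) : S.heightStep h r = h - 1 := by
  rw [heightStep, show S.kind r = _ from hr]

theorem heightStep_local {a : A} (ha : a ∈ S.locals) (h : ℕ) : S.heightStep h a = h := by
  rw [heightStep, show S.kind a = _ from ha]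

theorem mem_calls_or_mem_returns_or_mem_locals (S : PushdownAlphabet A) (a : A) :
    a ∈ S.calls ∨ a ∈ S.returns ∨ a ∈ S.locals := by
  simp only [calls, returns, locals, Set.mem_ofPred_eq]
  cases S.kind a <;> simp

theorem mem_locals {a : A} (hc : a ∉ S.calls) (hr : a ∉ S.returns) : a ∈ S.locals :=
  ((S.mem_calls_or_mem_returns_or_mem_locals a).resolve_left hc).resolve_left hr

theorem notMem_calls_of_mem_returns {a : A} (ha : a ∈ S.returns) : a ∉ S.calls :=
  fun hc => nomatch (show S.kind a = _ from hc).symm.trans ha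

theorem notMem_calls_of_mem_locals {a : A} (ha : a ∈ S.locals) : a ∉ S.calls :=
  fun hc => nomatch (show S.kind a = _ from hc).symm.trans ha

theorem notMem_returns_of_mem_locals {a : A} (ha : a ∈ S.locals) : a ∉ S.returns :=
  fun hr => nomatch (show S.kind a = _ from hr).symm.trans ha

theorem monotone_heightStep (a : A) : Monotone fun h => S.heightStep h a := by
  intro h h' hh
  unfold heightStep
  cases S.kind a <;> simp only <;> omega

theorem monotone_foldl_heightStep (w : List A) : Monotone fun h => w.foldl S.heightStep h := by
  induction w with
  | nil => exact monotone_id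
  | cons a w ih => exact ih.comp (monotone_heightStep a)

/-- No return of `u` empties the stack when `u` is read from stack height `h`. For `h = 1` this
says that `u` has no unmatched return. -/
def StaysPositive (S : PushdownAlphabet A) (h : ℕ) (u : Seq A) : Prop :=
  ∀ n, 0 < (u.take n).foldl S.heightStep h

theorem StaysPositive.pos {h : ℕ} {u : Seq A} (hu : S.StaysPositive h u) : 0 < h := by
  simpa only [Seq.take_zero, List.foldl_nil] using hu 0

theorem staysPositive_nil {h : ℕ} : S.StaysPositive h nil ↔ 0 < h := by
  simp [StaysPositive]

theorem staysPositive_cons {h : ℕ} {a : A} {u : Seq A} :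
    S.StaysPositive h (cons a u) ↔ 0 < h ∧ S.StaysPositive (S.heightStep h a) u := by
  refine ⟨fun hu => ⟨hu.pos, fun n => ?_⟩, fun ⟨hh, hu⟩ n => ?_⟩
  · simpa only [Seq.take_succ_cons, List.foldl_cons] using hu (n + 1)
  · cases n with
    | zero => simpa only [Seq.take_zero, List.foldl_nil] using hh
    | succ n => simpa only [Seq.take_succ_cons, List.foldl_cons] using hu n

theorem staysPositive_append {h : ℕ} {w : List A} {u : Seq A} :
    S.StaysPositive h (append (ofList w) u) ↔
      S.StaysPositive h (ofList w) ∧ S.StaysPositive (w.foldl S.heightStep h) u := by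
  induction w generalizing h with
  | nil =>
    simp only [Seq.ofList_nil, Seq.nil_append, List.foldl_nil, staysPositive_nil]
    exact ⟨fun hu => ⟨hu.pos, hu⟩, And.right⟩
  | cons a w ih =>
    simp only [Seq.ofList_cons, Seq.cons_append, staysPositive_cons, List.foldl_cons, ih, and_assoc]

theorem staysPositive_ofList_iff {h : ℕ} {w : List A} :
    S.StaysPositive h (ofList w) ↔ ∀ n, 0 < (w.take n).foldl S.heightStep h := by
  have htake (n : ℕ) : (ofList w).take n = w.take n := by
    simpa only [Seq.append_nil, Seq.take_nil, List.append_nil] using take_append w nil n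
  simp only [StaysPositive, htake]

theorem StaysPositive.foldl_pos {h : ℕ} {w : List A} (hw : S.StaysPositive h (ofList w)) :
    0 < w.foldl S.heightStep h := by
  simpa only [List.take_length] using staysPositive_ofList_iff.1 hw w.length

theorem staysPositive_local_cons {a : A} (ha : a ∈ S.locals) {h : ℕ} {u : Seq A} :
    S.StaysPositive h (cons a u) ↔ S.StaysPositive h u := by
  rw [staysPositive_cons, heightStep_local ha]
  exact ⟨And.right, fun hu => ⟨hu.pos, hu⟩⟩

theorem not_staysPositive_return_cons {r : A} (hr : r ∈ S.returns) {u : Seq A} :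
    ¬ S.StaysPositive 1 (cons r u) := fun hu => by
  rw [staysPositive_cons, heightStep_return hr] at hu
  exact hu.2.pos.false

theorem staysPositive_of_forall_eq_append {x : X → List A} (hx : ∀ s, x s ≠ []) {f : X → X}
    {v : X → Seq A} (hv : ∀ s, v s = append (ofList (x s)) (v (f s))) {P : X → Prop}
    (hf : ∀ s, P s → P (f s)) (hpos : ∀ s, P s → ∀ h, 0 < h → S.StaysPositive h (ofList (x s)))
    {s : X} (hs : P s) {h : ℕ} (hh : 0 < h) : S.StaysPositive h (v s) := by
  intro n
  induction n using Nat.strong_induction_on generalizing s h with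
  | _ n ih =>
  have hxs := hpos s hs h hh
  rw [hv, take_append, List.foldl_append]
  rcases le_or_gt n (x s).length with hn | hn
  · rw [Nat.sub_eq_zero_of_le hn, Seq.take_zero, List.foldl_nil]
    exact staysPositive_ofList_iff.1 hxs n
  · rw [List.take_of_length_le hn.le]
    have := List.length_pos_iff.2 (hx s)
    exact ih _ (by omega) (hf s hs) hxs.foldl_pos

/-- The finite words in which every call and every return is matched. -/
inductive IsBalanced (S : PushdownAlphabet A) : List A → Prop
  | nil : IsBalanced S []
  | loc {a : A} {w : List A} : a ∈ S.locals → IsBalanced S w → IsBalanced S (a :: w)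
  | matched {c r : A} {w v : List A} : c ∈ S.calls → r ∈ S.returns → IsBalanced S w →
      IsBalanced S v → IsBalanced S (c :: (w ++ r :: v))

theorem IsBalanced.foldl_heightStep {w : List A} (hw : S.IsBalanced w) {h : ℕ} (hh : 0 < h) :
    w.foldl S.heightStep h = h := by
  induction hw generalizing h with
  | nil => rfl
  | loc ha _ ih => rw [List.foldl_cons, heightStep_local ha, ih hh]
  | matched hc hr _ _ ihw ihv =>
    rw [List.foldl_cons, heightStep_call hc, List.foldl_append, ihw h.succ_pos, List.foldl_cons,
      heightStep_return hr, Nat.succ_sub_one, ihv hh]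

theorem ofList_cons_append_cons (c r : A) (w v : List A) :
    ofList (c :: (w ++ r :: v)) = cons c (append (ofList w) (cons r (ofList v))) := by
  rw [Seq.ofList_cons, Seq.ofList_append, Seq.ofList_cons]

theorem IsBalanced.staysPositive {w : List A} (hw : S.IsBalanced w) {h : ℕ} (hh : 0 < h) :
    S.StaysPositive h (ofList w) := by
  induction hw generalizing h with
  | nil => rwa [Seq.ofList_nil, staysPositive_nil]
  | loc ha _ ih => rw [Seq.ofList_cons, staysPositive_local_cons ha]; exact ih hh
  | matched hc hr hw _ ihw ihv =>
    rw [ofList_cons_append_cons, staysPositive_cons, heightStep_call hc, staysPositive_append,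
      hw.foldl_heightStep h.succ_pos, staysPositive_cons, heightStep_return hr]
    exact ⟨hh, ihw h.succ_pos, h.succ_pos, ihv hh⟩

theorem staysPositive_call_balanced_return_iff {c r : A} (hc : c ∈ S.calls) (hr : r ∈ S.returns)
    {w : List A} (hw : S.IsBalanced w) {h : ℕ} {u : Seq A} :
    S.StaysPositive h (cons c (append (ofList w) (cons r u))) ↔ S.StaysPositive h u := by
  rw [staysPositive_cons, staysPositive_append, heightStep_call hc,
    hw.foldl_heightStep h.succ_pos, staysPositive_cons, heightStep_return hr]
  exact ⟨fun hu => hu.2.2.2, fun hu => ⟨hu.pos, hw.staysPositive h.succ_pos, h.succ_pos, hu⟩⟩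

theorem exists_balanced_return_of_foldl_take_eq_zero {n : ℕ} {u : Seq A}
    (hn : (u.take n).foldl S.heightStep 1 = 0) :
    ∃ (w : List A) (r : A) (v : Seq A),
      S.IsBalanced w ∧ r ∈ S.returns ∧ u = append (ofList w) (cons r v) := by
  induction n using Nat.strong_induction_on generalizing u with
  | _ n ih =>
  cases u using Stream'.Seq.recOn with
  | nil => simp at hn
  | cons a u =>
  obtain _ | n := n
  · simp at hn
  rw [Seq.take_succ_cons, List.foldl_cons] at hn
  rcases S.mem_calls_or_mem_returns_or_mem_locals a with ha | ha | ha
  · rw [heightStep_call ha] at hn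
    have hdrop : (u.take n).foldl S.heightStep 1 = 0 :=
      Nat.eq_zero_of_le_zero (hn ▸ monotone_foldl_heightStep _ one_le_two)
    obtain ⟨w, r, u, hw, hr, rfl⟩ := ih n n.lt_succ_self hdrop
    obtain ⟨m, hm, hdrop'⟩ : ∃ m < n + 1, (u.take m).foldl S.heightStep 1 = 0 := by
      have hlen : w.length < n := by
        by_contra! hle
        rw [take_append, Nat.sub_eq_zero_of_le hle, Seq.take_zero, List.append_nil] at hdrop
        exact (staysPositive_ofList_iff.1 (hw.staysPositive one_pos) n).ne' hdrop
      obtain ⟨m, rfl⟩ := Nat.exists_eq_add_of_lt hlen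
      refine ⟨m, by omega, ?_⟩
      rw [take_append, List.take_of_length_le (by omega), List.foldl_append,
        hw.foldl_heightStep (by omega), show w.length + m + 1 - w.length = m + 1 by omega,
        Seq.take_succ_cons, List.foldl_cons, heightStep_return hr] at hn
      exact hn
    obtain ⟨w', r', v, hw', hr', rfl⟩ := ih m hm hdrop'
    exact ⟨a :: (w ++ r :: w'), r', v, .matched ha hr hw hw', hr', by
      simp [Seq.cons_append, Seq.append_assoc, Seq.ofList_append]⟩
  · exact ⟨[], a, u, .nil, ha, by rw [Seq.ofList_nil, Seq.nil_append]⟩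
  · rw [heightStep_local ha] at hn
    obtain ⟨w, r, v, hw, hr, rfl⟩ := ih n n.lt_succ_self hn
    exact ⟨a :: w, r, v, .loc ha hw, hr, by rw [Seq.ofList_cons, Seq.cons_append]⟩

theorem exists_balanced_return_of_not_staysPositive {u : Seq A} (hu : ¬ S.StaysPositive 1 u) :
    ∃ (w : List A) (r : A) (v : Seq A),
      S.IsBalanced w ∧ r ∈ S.returns ∧ u = append (ofList w) (cons r v) := by
  simp only [StaysPositive, not_forall, not_lt, Nat.le_zero] at hu
  exact exists_balanced_return_of_foldl_take_eq_zero hu.choose_spec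

theorem isMatchingReturn_call_balanced_return {c r : A} (hc : c ∈ S.calls) (hr : r ∈ S.returns)
    {w : List A} (hw : S.IsBalanced w) (u : Seq A) :
    S.IsMatchingReturn (cons c (append (ofList w) (cons r u))) 0 (w.length + 1) := by
  refine ⟨⟨c, by simp, hc⟩, ⟨Nat.succ_pos _, ⟨r, ?_, hr⟩, ?_⟩, ?_⟩
  · rw [Seq.get?_cons_succ, ← Seq.head_dropn, drop_length_append, Seq.head_cons]
    rfl
  · simp [stackHeight, take_append, heightStep_call hc, hw.foldl_heightStep, heightStep_return hr,
      List.take_of_length_le]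
  · rintro j ⟨-, -, hh⟩
    by_contra hlt
    have hpos := staysPositive_ofList_iff.1 (hw.staysPositive one_pos) j
    rw [Seq.take_succ_cons, take_append, Nat.sub_eq_zero_of_le (by omega)] at hh
    simp only [stackHeight, Seq.take_zero, List.append_nil, List.foldl_nil, List.foldl_cons,
      heightStep_call hc, zero_add] at hh
    omega

theorem not_isMatchingReturn_of_staysPositive {c : A} (hc : c ∈ S.calls) {u : Seq A}
    (hu : S.StaysPositive 1 u) (k : ℕ) : ¬ S.IsMatchingReturn (cons c u) 0 k := by
  rintro ⟨-, ⟨-, -, hh⟩, -⟩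
  simp only [stackHeight, Seq.take_succ_cons, Seq.take_zero, List.foldl_nil, List.foldl_cons,
    heightStep_call hc, zero_add] at hh
  exact (hu k).ne hh

theorem IsMatchingReturn.choose_eq {u : Seq A} {k k' : ℕ} (hk' : S.IsMatchingReturn u k k')
    (h : ∃ k', S.IsMatchingReturn u k k') : h.choose = k' :=
  h.choose_spec.2.unique hk'.2

theorem leftWord_nil : S.leftWord nil = nil := by simp [leftWord]

theorem rightWord_nil : S.rightWord nil = nil := by simp [rightWord]

theorem leftWord_cons_of_notMem_calls {a : A} (ha : a ∉ S.calls) (u : Seq A) :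
    S.leftWord (cons a u) = u := by simp [leftWord, ha]

theorem rightWord_cons_of_notMem_calls {a : A} (ha : a ∉ S.calls) (u : Seq A) :
    S.rightWord (cons a u) = nil := by simp [rightWord, ha]

theorem leftWord_unmatched {c : A} (hc : c ∈ S.calls) {u : Seq A} (hu : S.StaysPositive 1 u) :
    S.leftWord (cons c u) = nil := by
  simp [leftWord, hc, not_isMatchingReturn_of_staysPositive hc hu]

theorem rightWord_unmatched {c : A} (hc : c ∈ S.calls) {u : Seq A} (hu : S.StaysPositive 1 u) :
    S.rightWord (cons c u) = u := by
  simp [rightWord, hc, not_isMatchingReturn_of_staysPositive hc hu]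

theorem leftWord_matched {c r : A} (hc : c ∈ S.calls) (hr : r ∈ S.returns)
    {w : List A} (hw : S.IsBalanced w) (u : Seq A) :
    S.leftWord (cons c (append (ofList w) (cons r u))) = cons r u := by
  have hm := isMatchingReturn_call_balanced_return hc hr hw u
  simp only [leftWord, Seq.head_cons, hc, if_true, dif_pos (Exists.intro _ hm)]
  rw [hm.choose_eq, Seq.drop_succ_cons, drop_length_append]

theorem rightWord_matched {c r : A} (hc : c ∈ S.calls) (hr : r ∈ S.returns)
    {w : List A} (hw : S.IsBalanced w) (u : Seq A) :
    S.rightWord (cons c (append (ofList w) (cons r u))) = ofList w := by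
  have hm := isMatchingReturn_call_balanced_return hc hr hw u
  simp only [rightWord, Seq.head_cons, hc, if_true, dif_pos (Exists.intro _ hm), Seq.tail_cons]
  rw [hm.choose_eq, Nat.add_sub_cancel, take_append, Nat.sub_self, Seq.take_zero,
    List.append_nil, List.take_length]

end PushdownAlphabet

namespace LabeledTree

/-- The tree `x⟨l, r⟩` with root label `x`, left-hand subtree `l` and right-hand subtree `r`. -/
def node {B : Type*} (x : B) (l r : LabeledTree B) : LabeledTree B
  | [] => x
  | false :: b => l b
  | true :: b => r b

theorem node_eta {B : Type*} (t : LabeledTree B) :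
    node (t []) (fun b => t (false :: b)) (fun b => t (true :: b)) = t := by
  funext b
  rcases b with _ | ⟨_ | _, b⟩ <;> rfl

/-- The trees `t` and `t'` agree at all nodes of depth less than `n`. -/
def AgreeBelow {B : Type*} (n : ℕ) (t t' : LabeledTree B) : Prop :=
  ∀ b : TreeNode, b.length < n → t b = t' b

namespace AgreeBelow

variable {B : Type*} {m n : ℕ} {t t' l l' r r' : LabeledTree B}

theorem refl (n : ℕ) (t : LabeledTree B) : AgreeBelow n t t := fun _ _ => rfl

theorem mono (h : AgreeBelow n t t') (hmn : m ≤ n) : AgreeBelow m t t' :=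
  fun b hb => h b (hb.trans_le hmn)

theorem node {x : B} (hl : AgreeBelow n l l') (hr : AgreeBelow n r r') :
    AgreeBelow (n + 1) (LabeledTree.node x l r) (LabeledTree.node x l' r') := by
  rintro (_ | ⟨_ | _, b⟩) hb
  exacts [rfl, hl b (Nat.lt_of_succ_lt_succ hb), hr b (Nat.lt_of_succ_lt_succ hb)]

end AgreeBelow

end LabeledTree

open LabeledTree (node node_eta)

theorem branchPrefix_succ (β : ℕ → Bool) (n : ℕ) :
    branchPrefix β (n + 1) = β 0 :: branchPrefix (fun k => β (k + 1)) n := by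
  simp [branchPrefix, List.range_succ_eq_map, Function.comp_def]

theorem branchPrefix_succ' (β : ℕ → Bool) (n : ℕ) :
    branchPrefix β (n + 1) = branchPrefix β n ++ [β n] := by
  simp [branchPrefix, List.range_succ]

namespace BuchiTreeAutomaton

variable {B Q : Type*} {T : BuchiTreeAutomaton B Q}

theorem isAccepting_iff_forall_frequently {ρ : LabeledTree Q} :
    T.IsAccepting ρ ↔ ∀ β, ∃ᶠ n in atTop, ρ (branchPrefix β n) ∈ T.accept :=
  forall_congr' fun _ => Nat.frequently_atTop_iff_infinite.symm

theorem isAccepting_iff_forall_subtree {ρ : LabeledTree Q} :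
    T.IsAccepting ρ ↔ ∀ d, T.IsAccepting fun b => ρ (d :: b) := by
  have hshift (β : ℕ → Bool) : (∃ᶠ n in atTop, ρ (branchPrefix β n) ∈ T.accept) ↔
      ∃ᶠ n in atTop, ρ (β 0 :: branchPrefix (fun k => β (k + 1)) n) ∈ T.accept := by
    simp only [← branchPrefix_succ]
    rw [← map_add_atTop_eq_nat 1, frequently_map, map_add_atTop_eq_nat]
  simp only [isAccepting_iff_forall_frequently, hshift]
  exact ⟨fun h d β => h fun n => n.casesOn d β, fun h β => h (β 0) fun k => β (k + 1)⟩

/-- `ρ` is an accepting run on `t` that starts in `q` instead of the initial state. -/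
def IsAcceptingRun (T : BuchiTreeAutomaton B Q) (q : Q) (t : LabeledTree B)
    (ρ : LabeledTree Q) : Prop :=
  ρ [] = q ∧ (∀ b, (ρ b, t b, ρ (b ++ [false]), ρ (b ++ [true])) ∈ T.trans) ∧ T.IsAccepting ρ

/-- `T` accepts the tree `t` when it starts in `q` instead of the initial state. -/
def Accepts (T : BuchiTreeAutomaton B Q) (q : Q) (t : LabeledTree B) : Prop :=
  ∃ ρ, T.IsAcceptingRun q t ρ

theorem mem_language_iff {t : LabeledTree B} : t ∈ T.language ↔ T.Accepts T.init t :=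
  exists_congr fun _ => and_assoc

theorem isAcceptingRun_iff {q : Q} {t : LabeledTree B} {ρ : LabeledTree Q} :
    T.IsAcceptingRun q t ρ ↔ ρ [] = q ∧ (q, t [], ρ [false], ρ [true]) ∈ T.trans ∧
      ∀ d, T.IsAcceptingRun (ρ [d]) (fun b => t (d :: b)) (fun b => ρ (d :: b)) := by
  constructor
  · rintro ⟨rfl, htrans, hacc⟩
    exact ⟨rfl, htrans [],
      fun d => ⟨rfl, fun b => htrans (d :: b), isAccepting_iff_forall_subtree.1 hacc d⟩⟩
  · rintro ⟨rfl, hroot, hsub⟩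
    refine ⟨rfl, ?_, isAccepting_iff_forall_subtree.2 fun d => (hsub d).2.2⟩
    rintro (_ | ⟨d, b⟩)
    exacts [hroot, (hsub d).2.1 b]

theorem IsAcceptingRun.subtree {q : Q} {t : LabeledTree B} {ρ : LabeledTree Q}
    (h : T.IsAcceptingRun q t ρ) (b : TreeNode) :
    T.IsAcceptingRun (ρ b) (fun b' => t (b ++ b')) (fun b' => ρ (b ++ b')) := by
  induction b generalizing q t ρ with
  | nil => rwa [h.1]
  | cons d _ ih => exact ih ((isAcceptingRun_iff.1 h).2.2 d)

theorem accepts_node_iff {q : Q} {x : B} {l r : LabeledTree B} :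
    T.Accepts q (node x l r) ↔
      ∃ ql qr, (q, x, ql, qr) ∈ T.trans ∧ T.Accepts ql l ∧ T.Accepts qr r := by
  constructor
  · rintro ⟨ρ, hρ⟩
    obtain ⟨-, hroot, hsub⟩ := isAcceptingRun_iff.1 hρ
    exact ⟨_, _, hroot, ⟨_, hsub false⟩, ⟨_, hsub true⟩⟩
  · rintro ⟨ql, qr, hroot, ⟨ρl, hl⟩, ⟨ρr, hr⟩⟩
    obtain ⟨rfl, rfl⟩ : ρl [] = ql ∧ ρr [] = qr := ⟨hl.1, hr.1⟩
    exact ⟨node q ρl ρr, isAcceptingRun_iff.2 ⟨rfl, hroot, Bool.forall_bool.2 ⟨hl, hr⟩⟩⟩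

theorem Accepts.exists_eq_node {q : Q} {t : LabeledTree B} (h : T.Accepts q t) :
    ∃ x ql l qr r, t = node x l r ∧ (q, x, ql, qr) ∈ T.trans ∧ T.Accepts ql l ∧ T.Accepts qr r := by
  rw [← node_eta t, accepts_node_iff] at h
  obtain ⟨ql, qr, htrans, hl, hr⟩ := h
  exact ⟨_, ql, _, qr, _, (node_eta t).symm, htrans, hl, hr⟩

-- A counterexample at a node yields a counterexample at one of its children, hence a branch
-- without accepting states.
theorem Accepts.induction {P : Q → LabeledTree B → Prop}
    (haccept : ∀ q t, q ∈ T.accept → T.Accepts q t → P q t)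
    (hstep : ∀ q x ql l qr r, (q, x, ql, qr) ∈ T.trans → P ql l → P qr r → P q (node x l r))
    {q : Q} {t : LabeledTree B} (h : T.Accepts q t) : P q t := by
  obtain ⟨ρ, hρ⟩ := h
  let Bad (b : TreeNode) : Prop := ¬ P (ρ b) fun b' => t (b ++ b')
  have hchild (b : TreeNode) (hb : Bad b) : ∃ d, Bad (b ++ [d]) := by
    by_contra! hgood
    simp only [Bad, not_not, List.append_assoc, List.singleton_append] at hgood
    have hb' := hstep _ _ _ _ _ _ (hρ.2.1 b) (hgood false) (hgood true)
    refine hb ?_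
    rwa [← node_eta fun b' => t (b ++ b'), List.append_nil]
  choose! d hd using hchild
  by_contra hroot
  let path (n : ℕ) : TreeNode := n.rec [] fun _ b => b ++ [d b]
  have hbranch (n : ℕ) : branchPrefix (fun n => d (path n)) n = path n := by
    induction n with
    | zero => rfl
    | succ n ih => rw [branchPrefix_succ', ih]
  have hbad (n : ℕ) : Bad (path n) := by
    induction n with
    | zero => rwa [← hρ.1] at hroot
    | succ n ih => exact hd _ ih
  obtain ⟨n, hn⟩ := (hρ.2.2 fun n => d (path n)).nonempty
  rw [Set.mem_ofPred_eq, hbranch] at hn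
  exact hbad n (haccept _ _ hn ⟨_, hρ.subtree (path n)⟩)

open Classical in
/-- The run on `t` that starts in `q` and moves from a state `q'` at a subtree `t'` to the states
`next q' t'` at the children as long as `F q' t'` holds, and follows `run q' t'` from there on. -/
noncomputable def extendRun (F : Q → LabeledTree B → Prop) (next : Q → LabeledTree B → Bool → Q)
    (run : Q → LabeledTree B → LabeledTree Q) : Q → LabeledTree B → LabeledTree Q
  | q, _, [] => q
  | q, t, d :: b =>
    if F q t then extendRun F next run (next q t d) (fun b => t (d :: b)) b else run q t (d :: b)

section ExtendRun

variable {F : Q → LabeledTree B → Prop} {next : Q → LabeledTree B → Bool → Q}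
  {run : Q → LabeledTree B → LabeledTree Q} {q : Q} {t : LabeledTree B}

theorem extendRun_nil : extendRun F next run q t [] = q := rfl

theorem extendRun_cons (h : F q t) (d : Bool) (b : TreeNode) :
    extendRun F next run q t (d :: b) =
      extendRun F next run (next q t d) (fun b => t (d :: b)) b := by
  rw [extendRun, if_pos h]

theorem extendRun_eq_run (h : ¬ F q t) (hrun : run q t [] = q) :
    extendRun F next run q t = run q t := by
  funext b
  cases b with
  | nil => exact hrun.symm
  | cons d b => rw [extendRun, if_neg h]

theorem isAcceptingRun_extendRun {F : Q → LabeledTree B → Prop}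
    {next : Q → LabeledTree B → Bool → Q} {run : Q → LabeledTree B → LabeledTree Q}
    (haccept : ∀ q t, F q t → q ∈ T.accept)
    (hnext : ∀ q t, F q t → (q, t [], next q t false, next q t true) ∈ T.trans)
    (hchild : ∀ q t, F q t → ∀ d, F (next q t d) (fun b => t (d :: b)) ∨
      T.Accepts (next q t d) fun b => t (d :: b))
    (hrun : ∀ q t, T.Accepts q t → T.IsAcceptingRun q t (run q t))
    (h : F q t) : T.IsAcceptingRun q t (extendRun F next run q t) := by
  refine ⟨extendRun_nil, fun b => ?_, isAccepting_iff_forall_frequently.2 fun β =>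
    frequently_atTop.2 fun N => ?_⟩
  · induction b generalizing q t with
    | nil => simpa only [List.nil_append, extendRun_cons h, extendRun_nil] using hnext q t h
    | cons d b ih =>
      simp only [List.cons_append, extendRun_cons h]
      by_cases h' : F (next q t d) fun b => t (d :: b)
      · exact ih h'
      · have hacc := hrun _ _ ((hchild q t h d).resolve_left h')
        rw [extendRun_eq_run h' hacc.1]
        exact hacc.2.1 b
  · induction N generalizing q t β with
    | zero => exact ⟨0, le_rfl, haccept q t h⟩
    | succ N ih =>
      suffices ∃ n ≥ N, extendRun F next run (next q t (β 0)) (fun b => t (β 0 :: b))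
          (branchPrefix (fun k => β (k + 1)) n) ∈ T.accept by
        obtain ⟨n, hn, hmem⟩ := this
        exact ⟨n + 1, Nat.succ_le_succ hn, by rwa [branchPrefix_succ, extendRun_cons h]⟩
      by_cases h' : F (next q t (β 0)) fun b => t (β 0 :: b)
      · exact ih h' _
      · have hacc := hrun _ _ ((hchild q t h (β 0)).resolve_left h')
        rw [extendRun_eq_run h' hacc.1]
        exact frequently_atTop.1 (isAccepting_iff_forall_frequently.1 hacc.2.2 _) N

end ExtendRun

theorem accepts_of_coinduction {F : Q → LabeledTree B → Prop}
    (haccept : ∀ q t, F q t → q ∈ T.accept)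
    (hstep : ∀ q t, F q t → ∃ x ql l qr r, t = node x l r ∧ (q, x, ql, qr) ∈ T.trans ∧
      (F ql l ∨ T.Accepts ql l) ∧ (F qr r ∨ T.Accepts qr r))
    {q : Q} {t : LabeledTree B} (h : F q t) : T.Accepts q t := by
  have hnext (q t) (h : F q t) : ∃ next : Bool → Q,
      (q, t [], next false, next true) ∈ T.trans ∧ ∀ d,
        F (next d) (fun b => t (d :: b)) ∨ T.Accepts (next d) fun b => t (d :: b) := by
    obtain ⟨x, ql, l, qr, r, rfl, htrans, hl, hr⟩ := hstep q t h
    exact ⟨fun d => cond d qr ql, htrans, Bool.forall_bool.2 ⟨hl, hr⟩⟩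
  have : Inhabited Q := ⟨q⟩
  choose! next hnext hchild using hnext
  choose! run hrun using show ∀ q t, T.Accepts q t → ∃ ρ, T.IsAcceptingRun q t ρ from fun _ _ => id
  exact ⟨_, isAcceptingRun_extendRun haccept hnext hchild hrun h⟩

end BuchiTreeAutomaton

namespace PushdownAlphabet

variable {A : Type*} {S : PushdownAlphabet A}

theorem stackTree_eq_node (u : Seq A) :
    stackTree S u = node u.head (stackTree S (S.leftWord u)) (stackTree S (S.rightWord u)) :=
  (node_eta _).symm

theorem stackTree_nil : stackTree S nil = node none (stackTree S nil) (stackTree S nil) := by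
  conv_lhs => rw [stackTree_eq_node, Seq.head_nil, leftWord_nil, rightWord_nil]

theorem stackTree_cons_of_notMem_calls {a : A} (ha : a ∉ S.calls) (u : Seq A) :
    stackTree S (cons a u) = node (some a) (stackTree S u) (stackTree S nil) := by
  rw [stackTree_eq_node, Seq.head_cons, leftWord_cons_of_notMem_calls ha,
    rightWord_cons_of_notMem_calls ha]

theorem stackTree_unmatched {c : A} (hc : c ∈ S.calls) {u : Seq A} (hu : S.StaysPositive 1 u) :
    stackTree S (cons c u) = node (some c) (stackTree S nil) (stackTree S u) := by
  rw [stackTree_eq_node, Seq.head_cons, leftWord_unmatched hc hu, rightWord_unmatched hc hu]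

theorem stackTree_matched {c r : A} (hc : c ∈ S.calls) (hr : r ∈ S.returns)
    {w : List A} (hw : S.IsBalanced w) (u : Seq A) :
    stackTree S (cons c (append (ofList w) (cons r u))) =
      node (some c) (stackTree S (cons r u)) (stackTree S (ofList w)) := by
  rw [stackTree_eq_node, Seq.head_cons, leftWord_matched hc hr hw, rightWord_matched hc hr hw]

/-- The classes of words that the stack tree automaton distinguishes: the balanced finite words,
the infinite words without unmatched returns, and all infinite words. -/
inductive WordClass where
  | balanced
  | infinitePositive
  | infinite

instance : Finite WordClass :=
  Set.finite_univ_iff.1 <| (Set.toFinite {.balanced, .infinitePositive, .infinite}).subset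
    fun k _ => by cases k <;> simp

/-- The words that belong to a class. -/
def classWords (S : PushdownAlphabet A) : WordClass → Set (Seq A)
  | .balanced => ofList '' {w | S.IsBalanced w}
  | .infinitePositive => {u | ¬ u.Terminates ∧ S.StaysPositive 1 u}
  | .infinite => {u | ¬ u.Terminates}

theorem mem_classWords_iff {k : WordClass} (hk : k ≠ .balanced) {u : Seq A} :
    u ∈ S.classWords k ↔ ¬ u.Terminates ∧ (k = .infinitePositive → S.StaysPositive 1 u) := by
  cases k <;> simp_all [classWords]

/-- The states of the stack tree automaton. The state `bot` expects the tree of the empty word,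
`word k` the tree of a word of class `k`, and `ret k` the tree of a return followed by a word of
class `k`. -/
inductive StackState where
  | bot
  | word (k : WordClass)
  | ret (k : WordClass)

instance : Finite StackState :=
  Finite.of_surjective
    (fun o : Option (WordClass ⊕ WordClass) => o.elim .bot (Sum.elim .word .ret)) (by
      rintro (_ | k | k)
      exacts [⟨none, rfl⟩, ⟨some (.inl k), rfl⟩, ⟨some (.inr k), rfl⟩])

/-- The words whose stack trees are expected in a state. -/
def stateWords (S : PushdownAlphabet A) : StackState → Set (Seq A)
  | .bot => {nil}
  | .word k => S.classWords k
  | .ret k => {u | ∃ r ∈ S.returns, ∃ v ∈ S.classWords k, u = cons r v}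

/-- The transitions of the stack tree automaton, which follow the equations that define
`stackTree`. The rules `unmatched` and `matched` guess whether a call is matched. -/
inductive StackTrans (S : PushdownAlphabet A) :
    StackState → Option A → StackState → StackState → Prop
  | bot : StackTrans S .bot none .bot .bot
  | nil : StackTrans S (.word .balanced) none .bot .bot
  | flat {k : WordClass} {a : A} : a ∉ S.calls → (a ∈ S.returns → k = .infinite) →
      StackTrans S (.word k) (some a) (.word k) .bot
  | unmatched {k : WordClass} {c : A} : c ∈ S.calls → k ≠ .balanced →
      StackTrans S (.word k) (some c) .bot (.word .infinitePositive)
  | matched {k : WordClass} {c : A} : c ∈ S.calls →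
      StackTrans S (.word k) (some c) (.ret k) (.word .balanced)
  | ret {k : WordClass} {r : A} : r ∈ S.returns →
      StackTrans S (.ret k) (some r) (.word k) .bot

/-- The automaton that recognizes the stack trees of infinite words. The two nonaccepting states
expect finite words and must be left along every branch. -/
def stackAutomaton (S : PushdownAlphabet A) : BuchiTreeAutomaton (Option A) StackState where
  trans := {p | StackTrans S p.1 p.2.1 p.2.2.1 p.2.2.2}
  init := .word .infinite
  accept := {.word .balanced, .ret .balanced}ᶜ

theorem stackTrans_of_mem_trans {q ql qr : StackState} {x : Option A}
    (h : (q, x, ql, qr) ∈ S.stackAutomaton.trans) : StackTrans S q x ql qr := h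

theorem bot_mem_accept : StackState.bot ∈ S.stackAutomaton.accept := by simp [stackAutomaton]

theorem word_mem_accept_iff {k : WordClass} :
    .word k ∈ S.stackAutomaton.accept ↔ k ≠ .balanced := by simp [stackAutomaton]

theorem accepts_bot : S.stackAutomaton.Accepts .bot (stackTree S nil) := by
  refine BuchiTreeAutomaton.accepts_of_coinduction
    (F := fun q t => q = .bot ∧ t = stackTree S nil) ?_ ?_ ⟨rfl, rfl⟩
  · rintro _ _ ⟨rfl, -⟩
    exact bot_mem_accept
  · rintro _ _ ⟨rfl, rfl⟩
    exact ⟨_, _, _, _, _, stackTree_nil, .bot, .inl ⟨rfl, rfl⟩, .inl ⟨rfl, rfl⟩⟩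

theorem accepts_ret {k : WordClass} {r : A} (hr : r ∈ S.returns) {u : Seq A}
    (hu : S.stackAutomaton.Accepts (.word k) (stackTree S u)) :
    S.stackAutomaton.Accepts (.ret k) (stackTree S (cons r u)) := by
  rw [stackTree_cons_of_notMem_calls (notMem_calls_of_mem_returns hr)]
  exact BuchiTreeAutomaton.accepts_node_iff.2 ⟨_, _, .ret hr, hu, accepts_bot⟩

theorem accepts_word_balanced {w : List A} (hw : S.IsBalanced w) :
    S.stackAutomaton.Accepts (.word .balanced) (stackTree S (ofList w)) := by
  induction hw with
  | nil =>
    rw [Seq.ofList_nil, stackTree_nil]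
    exact BuchiTreeAutomaton.accepts_node_iff.2 ⟨_, _, .nil, accepts_bot, accepts_bot⟩
  | loc ha _ ih =>
    have hcall := notMem_calls_of_mem_locals ha
    rw [Seq.ofList_cons, stackTree_cons_of_notMem_calls hcall]
    exact BuchiTreeAutomaton.accepts_node_iff.2
      ⟨_, _, .flat hcall (absurd · (notMem_returns_of_mem_locals ha)), ih, accepts_bot⟩
  | matched hc hr hw _ ihw ihv =>
    rw [ofList_cons_append_cons, stackTree_matched hc hr hw]
    exact BuchiTreeAutomaton.accepts_node_iff.2 ⟨_, _, .matched hc, accepts_ret hr ihv, ihw⟩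

theorem accepts_of_notMem_accept {q : StackState} (hq : q ∉ S.stackAutomaton.accept) {u : Seq A}
    (hu : u ∈ S.stateWords q) : S.stackAutomaton.Accepts q (stackTree S u) := by
  obtain rfl | rfl := not_not.1 hq
  · obtain ⟨w, hw, rfl⟩ := hu
    exact accepts_word_balanced hw
  · obtain ⟨r, hr, _, ⟨w, hw, rfl⟩, rfl⟩ := hu
    exact accepts_ret hr (accepts_word_balanced hw)

theorem eq_infinite_and_mem_classWords_of_cons {k : WordClass} (hk : k ≠ .balanced) {a : A}
    (ha : a ∉ S.calls) {u : Seq A} (hu : cons a u ∈ S.classWords k) :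
    (a ∈ S.returns → k = .infinite) ∧ u ∈ S.classWords k := by
  rw [mem_classWords_iff hk, Seq.terminates_cons_iff] at hu
  obtain ⟨hinf, hpos⟩ := hu
  have hret (hr : a ∈ S.returns) : k ≠ .infinitePositive :=
    fun h => not_staysPositive_return_cons hr (hpos h)
  refine ⟨fun hr => ?_, (mem_classWords_iff hk).2 ⟨hinf, fun h => ?_⟩⟩
  · have := hret hr
    cases k <;> trivial
  · exact (staysPositive_local_cons (mem_locals ha fun hr => hret hr h)).1 (hpos h)

theorem mem_classWords_or_exists_balanced_return {k : WordClass} (hk : k ≠ .balanced) {c : A}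
    (hc : c ∈ S.calls) {u : Seq A} (hu : cons c u ∈ S.classWords k) :
    u ∈ S.classWords .infinitePositive ∨ ∃ (w : List A) (r : A) (v : Seq A), S.IsBalanced w ∧
      r ∈ S.returns ∧ v ∈ S.classWords k ∧ u = append (ofList w) (cons r v) := by
  rw [mem_classWords_iff hk, Seq.terminates_cons_iff] at hu
  obtain ⟨hinf, hpos⟩ := hu
  refine or_iff_not_imp_left.2 fun h => ?_
  obtain ⟨w, r, v, hw, hr, rfl⟩ :=
    exists_balanced_return_of_not_staysPositive fun hu => h ⟨hinf, hu⟩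
  rw [terminates_append_iff, Seq.terminates_cons_iff] at hinf
  rw [staysPositive_call_balanced_return_iff hc hr hw] at hpos
  exact ⟨w, r, v, hw, hr, (mem_classWords_iff hk).2 ⟨hinf, hpos⟩, rfl⟩

theorem exists_stackTrans_word {k : WordClass} (hk : k ≠ .balanced) {u : Seq A}
    (hu : u ∈ S.classWords k) :
    ∃ ql qr, StackTrans S (.word k) u.head ql qr ∧
      S.leftWord u ∈ S.stateWords ql ∧ S.rightWord u ∈ S.stateWords qr := by
  cases u using Stream'.Seq.recOn with
  | nil => exact absurd Seq.terminates_nil ((mem_classWords_iff hk).1 hu).1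
  | cons a u =>
  rw [Seq.head_cons]
  by_cases ha : a ∈ S.calls
  · obtain hu | ⟨w, r, v, hw, hr, hv, rfl⟩ := mem_classWords_or_exists_balanced_return hk ha hu
    · rw [leftWord_unmatched ha hu.2, rightWord_unmatched ha hu.2]
      exact ⟨_, _, .unmatched ha hk, rfl, hu⟩
    · rw [leftWord_matched ha hr hw, rightWord_matched ha hr hw]
      exact ⟨_, _, .matched ha, ⟨r, hr, v, hv, rfl⟩, ⟨w, hw, rfl⟩⟩
  · obtain ⟨hret, hu⟩ := eq_infinite_and_mem_classWords_of_cons hk ha hu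
    rw [leftWord_cons_of_notMem_calls ha, rightWord_cons_of_notMem_calls ha]
    exact ⟨_, _, .flat ha hret, hu, rfl⟩

theorem accepts_of_mem_stateWords {q : StackState} {u : Seq A} (hu : u ∈ S.stateWords q) :
    S.stackAutomaton.Accepts q (stackTree S u) := by
  let F (q : StackState) (t : LabeledTree (Option A)) : Prop :=
    q ∈ S.stackAutomaton.accept ∧ ∃ u ∈ S.stateWords q, t = stackTree S u
  have hF {q : StackState} {u : Seq A} (hu : u ∈ S.stateWords q) :
      F q (stackTree S u) ∨ S.stackAutomaton.Accepts q (stackTree S u) := by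
    by_cases hq : q ∈ S.stackAutomaton.accept
    exacts [.inl ⟨hq, u, hu, rfl⟩, .inr (accepts_of_notMem_accept hq hu)]
  refine (hF hu).elim (BuchiTreeAutomaton.accepts_of_coinduction (fun _ _ h => h.1) ?_) id
  rintro q _ ⟨hq, u, hu, rfl⟩
  suffices ∃ ql qr, StackTrans S q u.head ql qr ∧
      S.leftWord u ∈ S.stateWords ql ∧ S.rightWord u ∈ S.stateWords qr by
    obtain ⟨ql, qr, htrans, hl, hr⟩ := this
    exact ⟨_, _, _, _, _, stackTree_eq_node u, htrans, hF hl, hF hr⟩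
  cases q with
  | bot =>
    obtain rfl : u = nil := hu
    exact ⟨_, _, .bot, leftWord_nil, rightWord_nil⟩
  | word k => exact exists_stackTrans_word (word_mem_accept_iff.1 hq) hu
  | ret k =>
    obtain ⟨r, hr, v, hv, rfl⟩ := hu
    have hcall := notMem_calls_of_mem_returns hr
    rw [Seq.head_cons, leftWord_cons_of_notMem_calls hcall, rightWord_cons_of_notMem_calls hcall]
    exact ⟨_, _, .ret hr, hv, rfl⟩

theorem eq_stackTree_nil_of_accepts_bot {t : LabeledTree (Option A)}
    (h : S.stackAutomaton.Accepts .bot t) : t = stackTree S nil := by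
  funext b
  induction b generalizing t with
  | nil =>
    obtain ⟨x, _, l, _, r, rfl, htrans, -, -⟩ := h.exists_eq_node
    cases stackTrans_of_mem_trans htrans
    rw [stackTree_nil]
    rfl
  | cons d b ih =>
    obtain ⟨x, _, l, _, r, rfl, htrans, hl, hr⟩ := h.exists_eq_node
    cases stackTrans_of_mem_trans htrans
    rw [stackTree_nil]
    cases d
    exacts [ih hl, ih hr]

/-- The states that expect finite words. -/
def finiteStates : Set StackState := {.bot, .word .balanced, .ret .balanced}

theorem node_mem_image_stateWords {q ql qr : StackState} (hq : q ∈ finiteStates)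
    {x : Option A} {l r : LabeledTree (Option A)} (htrans : StackTrans S q x ql qr)
    (hl : ql ∈ finiteStates → l ∈ stackTree S '' S.stateWords ql)
    (hr : qr ∈ finiteStates → r ∈ stackTree S '' S.stateWords qr) :
    node x l r ∈ stackTree S '' S.stateWords q := by
  rw [finiteStates] at hl hr
  obtain rfl | rfl | rfl := hq
  · cases htrans
    obtain ⟨_, rfl, rfl⟩ := hl (by simp)
    obtain ⟨_, rfl, rfl⟩ := hr (by simp)
    exact ⟨_, rfl, stackTree_nil⟩
  · cases htrans with
    | nil =>
      obtain ⟨_, rfl, rfl⟩ := hl (by simp)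
      obtain ⟨_, rfl, rfl⟩ := hr (by simp)
      exact ⟨_, ⟨[], .nil, rfl⟩, stackTree_nil⟩
    | flat ha hret =>
      obtain ⟨_, ⟨w, hw, rfl⟩, rfl⟩ := hl (by simp)
      obtain ⟨_, rfl, rfl⟩ := hr (by simp)
      exact ⟨_, ⟨_ :: w, .loc (mem_locals ha fun hr => nomatch hret hr) hw, Seq.ofList_cons _ _⟩,
        stackTree_cons_of_notMem_calls ha _⟩
    | unmatched _ hk => exact absurd rfl hk
    | matched hc =>
      obtain ⟨_, ⟨r, hret, _, ⟨v, hv, rfl⟩, rfl⟩, rfl⟩ := hl (by simp)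
      obtain ⟨_, ⟨w, hw, rfl⟩, rfl⟩ := hr (by simp)
      exact ⟨_, ⟨_, .matched hc hret hw hv, ofList_cons_append_cons _ _ _ _⟩,
        stackTree_matched hc hret hw _⟩
  · cases htrans with
    | ret hret =>
      obtain ⟨v, hv, rfl⟩ := hl (by simp)
      obtain ⟨_, rfl, rfl⟩ := hr (by simp)
      exact ⟨_, ⟨_, hret, v, hv, rfl⟩,
        stackTree_cons_of_notMem_calls (notMem_calls_of_mem_returns hret) v⟩

theorem mem_image_stateWords_of_accepts {q : StackState} (hq : q ∈ finiteStates)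
    {t : LabeledTree (Option A)} (h : S.stackAutomaton.Accepts q t) :
    t ∈ stackTree S '' S.stateWords q := by
  refine BuchiTreeAutomaton.Accepts.induction
    (P := fun q t => q ∈ finiteStates → t ∈ stackTree S '' S.stateWords q)
    (fun q t hacc h hq => ?_)
    (fun q x ql l qr r htrans hl hr hq =>
      node_mem_image_stateWords hq (stackTrans_of_mem_trans htrans) hl hr) h hq
  obtain rfl | hq := hq
  · exact ⟨nil, rfl, (eq_stackTree_nil_of_accepts_bot h).symm⟩
  · exact absurd hq hacc

theorem exists_isBalanced_of_accepts {t : LabeledTree (Option A)}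
    (h : S.stackAutomaton.Accepts (.word .balanced) t) :
    ∃ w, S.IsBalanced w ∧ t = stackTree S (ofList w) := by
  obtain ⟨_, ⟨w, hw, rfl⟩, rfl⟩ := mem_image_stateWords_of_accepts (.inr (.inl rfl)) h
  exact ⟨w, hw, rfl⟩

/-- The tree `t` starts with the encoding of the finite word `x`. If the whole tree encodes a word
of class `k`, then the remaining tree `t'` encodes the rest of that word, of class `k'`. -/
inductive TreeBlock (S : PushdownAlphabet A) : WordClass → LabeledTree (Option A) → List A →
    WordClass → LabeledTree (Option A) → Prop
  | flat {k : WordClass} {a : A} {t : LabeledTree (Option A)} : a ∉ S.calls →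
      (a ∈ S.returns → k = .infinite) →
      TreeBlock S k (node (some a) t (stackTree S nil)) [a] k t
  | unmatched {k : WordClass} {c : A} {t : LabeledTree (Option A)} : c ∈ S.calls →
      TreeBlock S k (node (some c) (stackTree S nil) t) [c] .infinitePositive t
  | matched {k : WordClass} {c r : A} {w : List A} {t : LabeledTree (Option A)} : c ∈ S.calls →
      r ∈ S.returns → S.IsBalanced w →
      TreeBlock S k (node (some c) (node (some r) t (stackTree S nil)) (stackTree S (ofList w)))
        (c :: (w ++ [r])) k t

theorem exists_treeBlock {k : WordClass} (hk : k ≠ .balanced) {t : LabeledTree (Option A)}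
    (h : S.stackAutomaton.Accepts (.word k) t) :
    ∃ x k' t', k' ≠ .balanced ∧ S.stackAutomaton.Accepts (.word k') t' ∧
      S.TreeBlock k t x k' t' := by
  obtain ⟨_, _, l, _, r, rfl, htrans, hl, hr⟩ := h.exists_eq_node
  cases stackTrans_of_mem_trans htrans with
  | nil => exact absurd rfl hk
  | flat ha hret =>
    obtain rfl := eq_stackTree_nil_of_accepts_bot hr
    exact ⟨_, k, l, hk, hl, .flat ha hret⟩
  | unmatched hc =>
    obtain rfl := eq_stackTree_nil_of_accepts_bot hl
    exact ⟨_, .infinitePositive, r, by simp, hr, .unmatched hc⟩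
  | matched hc =>
    obtain ⟨w, hw, rfl⟩ := exists_isBalanced_of_accepts hr
    obtain ⟨_, _, v, _, _, rfl, htrans, hv, hnil⟩ := hl.exists_eq_node
    cases stackTrans_of_mem_trans htrans with
    | ret hret =>
      obtain rfl := eq_stackTree_nil_of_accepts_bot hnil
      exact ⟨_, k, v, hk, hv, .matched hc hret hw⟩

open LabeledTree (AgreeBelow)

namespace TreeBlock

variable {k k' : WordClass} {t t' : LabeledTree (Option A)} {x : List A}

theorem ne_nil (h : S.TreeBlock k t x k' t') : x ≠ [] := by
  cases h <;> exact List.cons_ne_nil _ _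

theorem eq_infinitePositive (h : S.TreeBlock .infinitePositive t x k' t') :
    k' = .infinitePositive := by
  cases h <;> rfl

theorem staysPositive (hx : S.TreeBlock .infinitePositive t x k' t') {h : ℕ} (hh : 0 < h) :
    S.StaysPositive h (ofList x) := by
  cases hx with
  | flat ha hret =>
    rw [Seq.ofList_cons, staysPositive_local_cons (mem_locals ha fun hr => nomatch hret hr),
      Seq.ofList_nil, staysPositive_nil]
    exact hh
  | unmatched hc =>
    rw [Seq.ofList_cons, staysPositive_cons, heightStep_call hc, Seq.ofList_nil, staysPositive_nil]
    exact ⟨hh, h.succ_pos⟩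
  | matched hc hr hw =>
    rw [ofList_cons_append_cons, staysPositive_call_balanced_return_iff hc hr hw, Seq.ofList_nil,
      staysPositive_nil]
    exact hh

theorem agreeBelow (h : S.TreeBlock k t x k' t') {u : Seq A} (hu : u ∈ S.classWords k') {n : ℕ}
    (hagree : AgreeBelow n (stackTree S u) t') :
    AgreeBelow (n + 1) (stackTree S (append (ofList x) u)) t := by
  cases h with
  | flat ha =>
    rw [Seq.ofList_cons, Seq.ofList_nil, Seq.cons_append, Seq.nil_append,
      stackTree_cons_of_notMem_calls ha]
    exact hagree.node (.refl _ _)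
  | unmatched hc =>
    rw [Seq.ofList_cons, Seq.ofList_nil, Seq.cons_append, Seq.nil_append,
      stackTree_unmatched hc hu.2]
    exact .node (.refl _ _) hagree
  | matched hc hr hw =>
    rw [ofList_cons_append_cons, Seq.ofList_nil, Seq.cons_append, Seq.append_assoc,
      Seq.cons_append, Seq.nil_append, stackTree_matched hc hr hw,
      stackTree_cons_of_notMem_calls (notMem_calls_of_mem_returns hr)]
    exact ((hagree.node (.refl _ _)).mono n.le_succ).node (.refl _ _)

end TreeBlock

-- The words read off along the chain of blocks form an infinite word. Its tree agrees with `t`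
-- because every block determines at least one more level of the tree.
theorem mem_image_classWords_of_accepts {k : WordClass} (hk : k ≠ .balanced)
    {t : LabeledTree (Option A)} (h : S.stackAutomaton.Accepts (.word k) t) :
    t ∈ stackTree S '' S.classWords k := by
  let X := {s : WordClass × LabeledTree (Option A) //
    s.1 ≠ .balanced ∧ S.stackAutomaton.Accepts (.word s.1) s.2}
  have hblock (s : X) : ∃ x, ∃ s' : X, S.TreeBlock s.1.1 s.1.2 x s'.1.1 s'.1.2 := by
    obtain ⟨x, k', t', hk', ht', hx⟩ := exists_treeBlock s.2.1 s.2.2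
    exact ⟨x, ⟨(k', t'), hk', ht'⟩, hx⟩
  choose x next hblock using hblock
  obtain ⟨v, hv⟩ := exists_forall_eq_append (fun s => (hblock s).ne_nil) next
  have hmem (s : X) : v s ∈ S.classWords s.1.1 := by
    refine (mem_classWords_iff s.2.1).2
      ⟨not_terminates_of_forall_eq_append (fun s => (hblock s).ne_nil) hv s, fun hs => ?_⟩
    refine staysPositive_of_forall_eq_append (fun s => (hblock s).ne_nil) hv
      (P := fun s => s.1.1 = .infinitePositive) (fun s hs => ?_) (fun s hs h hh => ?_) hs one_pos
    · exact (hs ▸ hblock s).eq_infinitePositive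
    · exact (hs ▸ hblock s).staysPositive hh
  have hagree (n : ℕ) : ∀ s : X, AgreeBelow n (stackTree S (v s)) s.1.2 := by
    induction n with
    | zero => exact fun _ _ hb => absurd hb (Nat.not_lt_zero _)
    | succ n ih => exact fun s => hv s ▸ (hblock s).agreeBelow (hmem _) (ih _)
  exact ⟨v ⟨(k, t), hk, h⟩, hmem ⟨(k, t), hk, h⟩,
    funext fun b => hagree _ _ b b.length.lt_succ_self⟩

theorem language_stackAutomaton (S : PushdownAlphabet A) :
    S.stackAutomaton.language = stackTree S '' {u | ¬ u.Terminates} := by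
  ext t
  rw [BuchiTreeAutomaton.mem_language_iff]
  constructor
  · exact mem_image_classWords_of_accepts (k := .infinite) (by simp)
  · rintro ⟨u, hu, rfl⟩
    exact accepts_of_mem_stateWords (q := .word .infinite) hu

theorem stackTrees_eq_image (S : PushdownAlphabet A) :
    stackTrees S = stackTree S '' {u | ¬ u.Terminates} := by
  rw [← range_ofStream, ← Set.range_comp]
  exact Set.ext fun t => exists_congr fun α => eq_comm

end PushdownAlphabet

theorem theorem1_general {A : Type*} (S : PushdownAlphabet A) :
    IsRegularTreeSet (stackTrees S) :=
  ⟨PushdownAlphabet.StackState, inferInstance, S.stackAutomaton, by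
    rw [S.language_stackAutomaton, S.stackTrees_eq_image]⟩

theorem theorem1 {A : Type*} [Finite A] (S : PushdownAlphabet A) :
    IsRegularTreeSet (stackTrees S) :=
  theorem1_general S
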